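/- **Definitions.** Let $R$ be a nonzero associative ring with $1$. A *left denominator set* of $R$ is a multiplicative submonoid $S\subseteq R$ with $0\notin S$ such that (i) for all $r\in R$, $s\in S$ one has $Sr\cap Rs\neq\emptyset$, and (ii) if $rs=0$ with $r\in R$, $s\in S$, then $tr=0$ for some $t\in S$. Put $\mathrm{ass}(S)=\{r\in R\mid sr=0\text{ for some }s\in S\}$ (an ideal of $R$), and let $S^{-1}R$ be the left localization. Let $\max.\mathrm{Den}_l(R)$ be the (non-empty) set of left denominator sets that are maximal with respect to inclusion. Let $T_l(R)$ be the union of all left denominator sets of $R$ that are contained in $\bigcap_{S\in\max.\mathrm{Den}_l(R)}S$; it is itself a left denominator set, the largest one contained in this intersection. Put $Q_l^s(R)=T_l(R)^{-1}R$, $\mathfrak l^s_R=\mathrm{ass}(T_l(R))$ and $\mathfrak l_R=\bigcap_{S\in\max.\mathrm{Den}_l(R)}\mathrm{ass}(S)$. Now let $R$ be left Artinian with Jacobson radical $\mathrm{rad}(R)$. Write $R/\mathrm{rad}(R)=\prod_{i=1}^n\bar R_i$ with $\bar R_i$ simple Artinian, and choose orthogonal idempotents $1_1,\dots,1_n$ of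 $R$ with $1=\sum_i 1_i$ such that $1_i$ lifts the identity element of $\bar R_i$. For non-empty $I\subseteq\{1,\dots,n\}$ let $e_I=\sum_{i\in I}1_i$. Let $\mathcal I'_l(R)=\{e_I\mid \emptyset\neq I\subseteq\{1,\dots,n\},\ e_IR(1-e_I)=0\}$, partially ordered by $e_I\le e_J\iff I\subseteq J$. For $e'\in\mathcal I'_l(R)$ the set $(1-e')R$ is an ideal of $R$. **Theorem.** Let $R$ be a nonzero left Artinian ring and let $e=\sum_{e'\in\min\mathcal I'_l(R)}e'$ be the sum of the minimal elements of $\mathcal I'_l(R)$ (for any choice of the $1_i$ as above). Then: 1. $T_l(R)=\bigcap_{S\in\max.\mathrm{Den}_l(R)}S=\{u\in R\mid u+(1-e')R\text{ is a unit of }R/(1-e')R\text{ for all }e'\in\min\mathcal I'_l(R)\}$. 2. $eR(1-e)=0$, so $(1-e)R$ is an ideal of $R$, and $\mathfrak l^s_R=\mathfrak l_R=(1-e)R$. 3. There are ring isomorphisms $$Q_l^s(R)\simeq R/\mathfrak l^s_R\simeq R/(1-e)R\simeq\prod_{e'\in\min\mathcal I'_l(R)}R/(1-e')R\simeq\prod_{S\in\max.\mathrm{Den}_l(R)}S^{-1}R,$$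 each of them compatible with the canonical ring homomorphisms from $R$. -/

import Mathlib

universe u

/-- The left denominator sets of a ring `R`: multiplicative submonoids not containing `0` that
satisfy the left Ore condition and are left reversible. -/
structure IsLeftDenominatorSet {R : Type*} [Ring R] (S : Submonoid R) : Prop where
  zero_notMem : (0 : R) ∉ S
  ore : ∀ r : R, ∀ s ∈ S, ∃ s' ∈ S, ∃ r' : R, s' * r = r' * s
  reversible : ∀ r : R, ∀ s ∈ S, r * s = 0 → ∃ t ∈ S, t * r = 0

namespace IsLeftDenominatorSet

variable {R : Type*} [Ring R] {S : Submonoid R}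

theorem nonempty_oreSet (hS : IsLeftDenominatorSet S) : Nonempty (OreLocalization.OreSet S) := by
  rw [OreLocalization.nonempty_oreSet_iff]
  refine ⟨fun r₁ r₂ s h => ?_, fun r s => ?_⟩
  · obtain ⟨t, ht, h0⟩ := hS.reversible (r₁ - r₂) s s.2 (by rw [sub_mul, h, sub_self])
    exact ⟨⟨t, ht⟩, by simpa [mul_sub, sub_eq_zero] using h0⟩
  · obtain ⟨s', hs', r', h⟩ := hS.ore r s s.2
    exact ⟨r', ⟨s', hs'⟩, h⟩

/-- The data needed by Mathlib's Ore localization. -/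
@[reducible]
noncomputable def oreSet (hS : IsLeftDenominatorSet S) : OreLocalization.OreSet S :=
  Classical.choice hS.nonempty_oreSet

/-- The left localization `S⁻¹R` of `R` at a left denominator set `S`. -/
def Localization (hS : IsLeftDenominatorSet S) : Type _ :=
  letI := hS.oreSet
  OreLocalization S R

noncomputable instance (hS : IsLeftDenominatorSet S) : Ring hS.Localization :=
  letI := hS.oreSet
  inferInstanceAs (Ring (OreLocalization S R))

/-- The canonical ring homomorphism `R → S⁻¹R`, `r ↦ r / 1`. -/
noncomputable def toLocalization (hS : IsLeftDenominatorSet S) : R →+* hS.Localization :=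
  letI := hS.oreSet
  (OreLocalization.numeratorRingHom : R →+* OreLocalization S R)

/-- `ass (S) = {r ∈ R | s r = 0 for some s ∈ S}`, an ideal of `R`. -/
def ass (hS : IsLeftDenominatorSet S) : Ideal R where
  carrier := {r | ∃ s ∈ S, s * r = 0}
  zero_mem' := ⟨1, S.one_mem, mul_zero _⟩
  add_mem' := by
    rintro a b ⟨s, hs, ha⟩ ⟨t, ht, hb⟩
    obtain ⟨s', hs', r', h⟩ := hS.ore s t ht
    refine ⟨s' * s, S.mul_mem hs' hs, ?_⟩
    rw [mul_add, mul_assoc, ha, h, mul_assoc, hb, mul_zero, mul_zero, add_zero]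
  smul_mem' := by
    rintro c a ⟨s, hs, ha⟩
    obtain ⟨s', hs', r', h⟩ := hS.ore c s hs
    refine ⟨s', hs', ?_⟩
    rw [smul_eq_mul, ← mul_assoc, h, mul_assoc, ha, mul_zero]

instance (hS : IsLeftDenominatorSet S) : hS.ass.IsTwoSided where
  mul_mem_of_left := by
    rintro a b ⟨s, hs, ha⟩
    exact ⟨s, hs, by rw [← mul_assoc, ha, zero_mul]⟩

end IsLeftDenominatorSet

section LargestStrong

variable (R : Type*) [Ring R]

/-- `max.Den_l(R)`: the maximal left denominator sets of `R` with respect to inclusion. -/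
def maxLeftDen : Set (Submonoid R) := {S | Maximal IsLeftDenominatorSet S}

variable {R} in
theorem isLeftDenominatorSet_of_mem_maxLeftDen {S : Submonoid R} (hS : S ∈ maxLeftDen R) :
    IsLeftDenominatorSet S := hS.prop

/-- The set of strongly left localizable elements: the intersection of all maximal left
denominator sets. -/
def stronglyLeftLocalizable : Set R := ⋂ S ∈ maxLeftDen R, (S : Set R)

/-- The strong left denominator sets: those that consist of strongly left localizable elements. -/
def strongLeftDen : Set (Submonoid R) :=
  {S | IsLeftDenominatorSet S ∧ (S : Set R) ⊆ stronglyLeftLocalizable R}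

/-- `T_l(R)`, the join (indeed the union) of all strong left denominator sets; it is the largest
one. -/
def largestStrongLeftDen : Submonoid R := sSup (strongLeftDen R)

theorem isLeftDenominatorSet_one [Nontrivial R] :
    IsLeftDenominatorSet (⊥ : Submonoid R) where
  zero_notMem := by simp [Submonoid.mem_bot]
  ore r s hs := by
    rw [Submonoid.mem_bot] at hs
    exact ⟨1, Submonoid.one_mem _, r, by rw [hs, one_mul, mul_one]⟩
  reversible r s hs h := by
    rw [Submonoid.mem_bot] at hs
    exact ⟨1, Submonoid.one_mem _, by rwa [hs, mul_one, ← one_mul r] at h⟩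

variable {R} in
/-- A join of left denominator sets is one as soon as it does not contain `0`. -/
theorem isLeftDenominatorSet_sSup {C : Set (Submonoid R)} (hC : ∀ S ∈ C, IsLeftDenominatorSet S)
    (h0 : (0 : R) ∉ sSup C) : IsLeftDenominatorSet (sSup C) := by
  have hle : ∀ S ∈ C, ∀ x ∈ S, x ∈ sSup C := fun S hS x hx => (le_sSup hS : S ≤ sSup C) hx
  have key : ∀ x ∈ sSup C, ∃ _ : x ∈ sSup C,
      (∀ r : R, ∃ s' ∈ sSup C, ∃ r' : R, s' * r = r' * x) ∧
      (∀ r : R, r * x = 0 → ∃ t ∈ sSup C, t * r = 0) := by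
    intro x hx
    rw [sSup_eq_iSup', Submonoid.iSup_eq_closure] at hx
    induction hx using Submonoid.closure_induction with
    | mem x hx =>
      obtain ⟨⟨S, hS⟩, hxS⟩ := Set.mem_iUnion.1 hx
      refine ⟨hle S hS x hxS, fun r => ?_, fun r hr => ?_⟩
      · obtain ⟨s', hs', r', h⟩ := (hC S hS).ore r x hxS
        exact ⟨s', hle S hS s' hs', r', h⟩
      · obtain ⟨t, ht, h⟩ := (hC S hS).reversible r x hxS hr
        exact ⟨t, hle S hS t ht, h⟩
    | one =>
      exact ⟨Submonoid.one_mem _, fun r => ⟨1, Submonoid.one_mem _, r, by simp⟩,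
        fun r hr => ⟨1, Submonoid.one_mem _, by simpa using hr⟩⟩
    | mul x y _ _ ihx ihy =>
      obtain ⟨hx, ox, rx⟩ := ihx
      obtain ⟨hy, oy, ry⟩ := ihy
      refine ⟨Submonoid.mul_mem _ hx hy, fun r => ?_, fun r hr => ?_⟩
      · obtain ⟨s, hs, r', h⟩ := oy r
        obtain ⟨s', hs', r'', h'⟩ := ox r'
        exact ⟨s' * s, Submonoid.mul_mem _ hs' hs, r'', by
          rw [mul_assoc, h, ← mul_assoc, h', mul_assoc]⟩
      · obtain ⟨t, ht, h⟩ := ry (r * x) (by rwa [mul_assoc])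
        obtain ⟨t', ht', h'⟩ := rx (t * r) (by rwa [mul_assoc])
        exact ⟨t' * t, Submonoid.mul_mem _ ht' ht, by rwa [mul_assoc]⟩
  exact ⟨h0, fun r s hs => (key s hs).2.1 r, fun r s hs => (key s hs).2.2 r⟩

theorem maxLeftDen_nonempty [Nontrivial R] : (maxLeftDen R).Nonempty := by
  obtain ⟨S, -, hS⟩ := zorn_le_nonempty₀ {S : Submonoid R | IsLeftDenominatorSet S}
    (fun C hC hchain S hS => ⟨sSup C, isLeftDenominatorSet_sSup hC (fun h => by
      obtain ⟨T, hT, h0⟩ := (Submonoid.mem_sSup_of_directedOn ⟨S, hS⟩ hchain.directedOn).1 h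
      exact (hC hT).zero_notMem h0), fun T hT => le_sSup hT⟩)
    ⊥ (isLeftDenominatorSet_one R)
  exact ⟨S, hS⟩

theorem isGreatest_largestStrongLeftDen [Nontrivial R] :
    IsGreatest (strongLeftDen R) (largestStrongLeftDen R) := by
  have hsub : ∀ S ∈ maxLeftDen R, largestStrongLeftDen R ≤ S := fun S hS =>
    sSup_le fun T hT x hx => Set.mem_iInter₂.1 (hT.2 hx) S hS
  refine ⟨⟨isLeftDenominatorSet_sSup (fun S hS => hS.1) fun h => ?_, fun x hx =>
    Set.mem_iInter₂.2 fun S hS => hsub S hS hx⟩, fun T hT => le_sSup hT⟩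
  obtain ⟨S, hS⟩ := maxLeftDen_nonempty R
  exact hS.prop.zero_notMem (hsub S hS h)

theorem coe_largestStrongLeftDen [Nontrivial R] :
    (largestStrongLeftDen R : Set R) = ⋃ S ∈ strongLeftDen R, (S : Set R) := by
  refine Set.Subset.antisymm (fun x hx => ?_) (Set.iUnion₂_subset fun S hS x hx => ?_)
  · exact Set.mem_iUnion₂.2 ⟨_, (isGreatest_largestStrongLeftDen R).1, hx⟩
  · exact (isGreatest_largestStrongLeftDen R).2 hS hx

theorem isLeftDenominatorSet_largestStrongLeftDen [Nontrivial R] :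
    IsLeftDenominatorSet (largestStrongLeftDen R) :=
  (isGreatest_largestStrongLeftDen R).1.1

/-- `Q_l^s(R) = T_l(R)⁻¹R`, the largest strong left quotient ring of `R`. -/
abbrev LargestStrongLeftQuotientRing [Nontrivial R] : Type _ :=
  (isLeftDenominatorSet_largestStrongLeftDen R).Localization

/-- The canonical homomorphism `R → Q_l^s(R)`. -/
noncomputable abbrev toLargestStrongLeftQuotientRing [Nontrivial R] :
    R →+* LargestStrongLeftQuotientRing R :=
  (isLeftDenominatorSet_largestStrongLeftDen R).toLocalization

/-- The strong left localization radical of `R`: the ideal `ass (T_l(R))`. -/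
abbrev strongLeftLocalizationRadical [Nontrivial R] : Ideal R :=
  (isLeftDenominatorSet_largestStrongLeftDen R).ass

/-- The left localization radical of `R`: the intersection of the ideals `ass (S)` over all
maximal left denominator sets `S`. -/
def leftLocalizationRadical : Ideal R :=
  ⨅ S : maxLeftDen R, (isLeftDenominatorSet_of_mem_maxLeftDen S.2).ass

end LargestStrong

/-- The ideal `(1 - e)R` of `R`, for an element `e` with `e R (1 - e) = 0`. -/
def oneSubIdeal {R : Type*} [Ring R] (e : R) (he : ∀ r : R, e * r * (1 - e) = 0) : Ideal R where
  carrier := {x | ∃ r : R, x = (1 - e) * r}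
  zero_mem' := ⟨0, (mul_zero _).symm⟩
  add_mem' := by
    rintro _ _ ⟨a, rfl⟩ ⟨b, rfl⟩
    exact ⟨a + b, (mul_add _ _ _).symm⟩
  smul_mem' := by
    rintro c _ ⟨a, rfl⟩
    refine ⟨c * (1 - e) * a, ?_⟩
    have h : c * (1 - e) = (1 - e) * (c * (1 - e)) := by
      rw [sub_mul 1 e (c * (1 - e)), ← mul_assoc e, he c, one_mul, sub_zero]
    rw [smul_eq_mul, ← mul_assoc, ← mul_assoc, ← h]

instance {R : Type*} [Ring R] (e : R) (he : ∀ r : R, e * r * (1 - e) = 0) :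
    (oneSubIdeal e he).IsTwoSided where
  mul_mem_of_left := by
    rintro _ b ⟨r, rfl⟩
    exact ⟨r * b, mul_assoc _ _ _⟩

/-- A choice of a decomposition of `R / rad R` into a finite direct product of simple Artinian
rings `Block i`, together with orthogonal idempotents `idem i` of `R`, with sum `1`, such that
`idem i` lifts the identity element of `Block i`. -/
structure BlockIdempotents (R : Type u) [Ring R] where
  n : ℕ
  Block : Fin n → Type u
  [ring : ∀ i, Ring (Block i)]
  [simple : ∀ i, IsSimpleRing (Block i)]
  [artinian : ∀ i, IsArtinianRing (Block i)]
  equiv : (R ⧸ Ring.jacobson R) ≃+* (∀ i, Block i)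
  idem : Fin n → R
  complete : CompleteOrthogonalIdempotents idem
  lifts : ∀ i, equiv (Ideal.Quotient.mk (Ring.jacobson R) (idem i)) = Pi.single i 1

namespace BlockIdempotents

variable {R : Type u} [Ring R]

/-- Such choices exist for every left Artinian ring. -/
theorem nonempty_of_isArtinianRing [IsArtinianRing R] : Nonempty (BlockIdempotents R) := by
  obtain ⟨n, D, d, hD, hd, ⟨φ⟩⟩ :=
    IsSemisimpleRing.exists_ringEquiv_pi_matrix_divisionRing (R ⧸ Ring.jacobson R)
  obtain ⟨k, hk⟩ := IsSemiprimaryRing.isNilpotent (R := R)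
  have hnil : ∀ x ∈ RingHom.ker (Ideal.Quotient.mk (Ring.jacobson R)), IsNilpotent x := by
    intro x hx
    rw [Ideal.mk_ker] at hx
    exact ⟨k, by simpa [hk] using Ideal.pow_mem_pow hx k⟩
  obtain ⟨a, ha, hlift⟩ := CompleteOrthogonalIdempotents.lift_of_isNilpotent_ker
    (Ideal.Quotient.mk (Ring.jacobson R)) hnil
    ((CompleteOrthogonalIdempotents.single
      (fun i => Matrix (Fin (d i)) (Fin (d i)) (D i))).map φ.symm.toRingHom)
    (fun i => Ideal.Quotient.mk_surjective _)
  exact ⟨{ n := n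
           Block := fun i => Matrix (Fin (d i)) (Fin (d i)) (D i)
           equiv := φ
           idem := a
           complete := ha
           lifts := fun i => by
            have h := congrFun hlift i
            simp only [Function.comp_apply] at h
            rw [h]
            exact φ.apply_symm_apply _ }⟩

/-- `e_I = ∑ i ∈ I, 1_i`. -/
def partialSum (B : BlockIdempotents R) (I : Finset (Fin B.n)) : R := ∑ i ∈ I, B.idem i

/-- The set `𝓘'_l(R)` of all `e_I`, `I` non-empty, with `e_I R (1 - e_I) = 0`, given by the index
sets `I` and ordered by inclusion of index sets (`I ↦ e_I` is injective). -/
def leftIndex (B : BlockIdempotents R) : Set (Finset (Fin B.n)) :=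
  {I | I.Nonempty ∧ ∀ r : R, B.partialSum I * r * (1 - B.partialSum I) = 0}

/-- The minimal elements of `𝓘'_l(R)`. -/
def minLeftIndex (B : BlockIdempotents R) : Set (Finset (Fin B.n)) :=
  {I | Minimal (· ∈ B.leftIndex) I}

/-- `e`, the sum of the minimal elements of `𝓘'_l(R)`. -/
noncomputable def sumMin (B : BlockIdempotents R) : R :=
  ∑ I ∈ (Set.toFinite B.minLeftIndex).toFinset, B.partialSum I

theorem eq_zero_of_mem_minLeftIndex (B : BlockIdempotents R) {I : Finset (Fin B.n)}
    (hI : I ∈ B.minLeftIndex) (r : R) : B.partialSum I * r * (1 - B.partialSum I) = 0 :=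
  hI.prop.2 r

/-- The ideal `(1 - e')R` for a minimal element `e'` of `𝓘'_l(R)`. -/
abbrev minIdeal (B : BlockIdempotents R) (I : B.minLeftIndex) : Ideal R :=
  oneSubIdeal (B.partialSum I.1) (B.eq_zero_of_mem_minLeftIndex I.2)

end BlockIdempotents

/-!
The maximal left denominator sets of a left Artinian ring `R` are determined as follows.

Let `S` be a left denominator set with `a = ass S`. Left annihilators of subsets of `R` satisfy the
descending chain condition, so there is a single `t ∈ S` with `t a = 0`
(`IsLeftDenominatorSet.exists_mul_ass_eq_zero`). Elements of `S` are regular modulo `a`, hence units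
of the Artinian ring `R / a` (`IsLeftDenominatorSet.isUnit_mk_ass`); it follows that `S⁻¹R = R / a`,
and that `a = gR` for an idempotent `g`, since `wt = 1 - g` with `g ∈ a` gives `x = g x` on `a`
(`IsLeftDenominatorSet.exists_mem_ass_mul_eq`). An ideal of the form `gR` is, up to the radical, a
product of blocks, and comparing idempotents modulo the nilpotent radical yields
`a = (1 - e_I)R` where `I` is the set of the `i` with `1_i ∉ a`
(`BlockIdempotents.exists_leftIndex_mem_iff`).

Conversely, for `I ∈ 𝓘'_l(R)` the elements that are units modulo `(1 - e_I)R` form a left denominator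
set `S_I` with `ass S_I = (1 - e_I)R`. Every left denominator set is thus contained in some `S_I`, and
`S_I ⊆ S_K` when `K ⊆ I`. Hence the maximal left denominator sets are exactly the `S_I` with `I`
minimal (`BlockIdempotents.mem_maxLeftDen_iff`).

Distinct minimal index sets are disjoint, so `e = e_U` for their union `U`, which again lies in
`𝓘'_l(R)`. By the Chinese remainder theorem `R / (1 - e_U)R` is the product of the `R / (1 - e_I)R`;
therefore the intersection of all the `S_I` is the left denominator set `S_U`, which must be `T_l(R)`.
All the rings in the statement are then quotients of `R` by the same ideal `(1 - e_U)R`.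
-/

/-! ### Quotients of a ring by the same kernel -/

theorem RingHom.exists_ringEquiv_of_ker_eq {R A C : Type*} [Ring R] [Ring A] [Ring C]
    (f : R →+* A) (g : R →+* C) (hf : Function.Surjective f) (hg : Function.Surjective g)
    (h : ∀ r, f r = 0 ↔ g r = 0) : ∃ φ : A ≃+* C, ∀ r, φ (f r) = g r := by
  have hk : RingHom.ker f = RingHom.ker g := by
    ext r
    rw [RingHom.mem_ker, RingHom.mem_ker, h]
  refine ⟨(RingHom.quotientKerEquivOfSurjective hf).symm.trans
    ((Ideal.quotEquivOfEq hk).trans (RingHom.quotientKerEquivOfSurjective hg)), fun r => ?_⟩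
  have hr : (RingHom.quotientKerEquivOfSurjective hf).symm (f r) =
      Ideal.Quotient.mk (RingHom.ker f) r := by
    rw [RingEquiv.symm_apply_eq]
    rfl
  rw [RingEquiv.trans_apply, hr]
  rfl

/-- A surjection onto a simple ring maps a two-sided ideal to `0` or onto everything. -/
theorem RingHom.map_eq_zero_or_exists_eq_one {R A : Type*} [Ring R] [Ring A] [IsSimpleRing A]
    (f : R →+* A) (hf : Function.Surjective f) (a : Ideal R) [a.IsTwoSided] :
    (∀ y ∈ a, f y = 0) ∨ ∃ y ∈ a, f y = 1 := by
  let J : TwoSidedIdeal A := TwoSidedIdeal.mk' {b | ∃ y ∈ a, f y = b}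
    ⟨0, a.zero_mem, map_zero f⟩
    (by
      rintro _ _ ⟨x, hx, rfl⟩ ⟨y, hy, rfl⟩
      exact ⟨x + y, a.add_mem hx hy, map_add f x y⟩)
    (by
      rintro _ ⟨x, hx, rfl⟩
      exact ⟨-x, a.neg_mem hx, map_neg f x⟩)
    (by
      rintro c _ ⟨x, hx, rfl⟩
      obtain ⟨d, rfl⟩ := hf c
      exact ⟨d * x, a.mul_mem_left d hx, map_mul f d x⟩)
    (by
      rintro _ c ⟨x, hx, rfl⟩
      obtain ⟨d, rfl⟩ := hf c
      exact ⟨x * d, a.mul_mem_right d hx, map_mul f x d⟩)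
  have hJ : ∀ b, b ∈ J ↔ ∃ y ∈ a, f y = b := fun b => TwoSidedIdeal.mem_mk' _ _ _ _ _ _ b
  rcases IsSimpleRing.simple.eq_bot_or_eq_top J with h | h
  · left
    intro y hy
    have hm : f y ∈ J := (hJ _).2 ⟨y, hy, rfl⟩
    rwa [h, TwoSidedIdeal.mem_bot] at hm
  · right
    have hm : (1 : A) ∈ J := by
      rw [h]
      trivial
    exact (hJ _).1 hm

/-! ### Left denominator sets of a left Artinian ring -/

namespace IsLeftDenominatorSet

section General

variable {R : Type*} [Ring R] {S : Submonoid R}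

theorem mem_ass_of_mul_mem_ass (hS : IsLeftDenominatorSet S) {s r : R} (hs : s ∈ S)
    (h : s * r ∈ hS.ass) : r ∈ hS.ass := by
  obtain ⟨t, ht, h⟩ := h
  exact ⟨t * s, S.mul_mem ht hs, by rw [mul_assoc, h]⟩

theorem mem_ass_of_mul_mem_ass_right (hS : IsLeftDenominatorSet S) {s r : R} (hs : s ∈ S)
    (h : r * s ∈ hS.ass) : r ∈ hS.ass := by
  obtain ⟨t, ht, h⟩ := h
  rw [← mul_assoc] at h
  exact hS.mem_ass_of_mul_mem_ass ht (hS.reversible _ s hs h)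

theorem toLocalization_eq_zero_iff (hS : IsLeftDenominatorSet S) (r : R) :
    hS.toLocalization r = 0 ↔ r ∈ hS.ass := by
  let := hS.oreSet
  change (r /ₒ (1 : S) : OreLocalization S R) = 0 ↔ _
  rw [← OreLocalization.zero_oreDiv' (1 : S), OreLocalization.oreDiv_eq_iff]
  constructor
  · rintro ⟨u, v, h1, h2⟩
    refine ⟨u, u.2, ?_⟩
    have h2' : (u : R) = v := by simpa using h2
    rw [h2']
    simpa using h1.symm
  · rintro ⟨s, hs, h⟩
    exact ⟨⟨s, hs⟩, s, by simpa [Submonoid.smul_def] using h.symm, by simp⟩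

/-- If the elements of `S` are invertible modulo `ass S`, then `s⁻¹ r` is the image of `v r` for any
`v` inverse to `s` modulo `ass S`, so that no denominators are needed. -/
theorem toLocalization_surjective (hS : IsLeftDenominatorSet S)
    (hu : ∀ s ∈ S, IsUnit (Ideal.Quotient.mk hS.ass s)) :
    Function.Surjective hS.toLocalization := by
  let := hS.oreSet
  intro q
  change OreLocalization S R at q
  induction q using OreLocalization.ind with
  | _ r s =>
    obtain ⟨v, hv⟩ := Ideal.Quotient.mk_surjective (↑(hu s s.2).unit⁻¹ : R ⧸ hS.ass)
    have h1 : Ideal.Quotient.mk hS.ass (s * v * r - r) = 0 := by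
      rw [map_sub, map_mul, map_mul, hv, IsUnit.mul_val_inv, one_mul, sub_self]
    rw [Ideal.Quotient.eq_zero_iff_mem] at h1
    obtain ⟨t, ht, h⟩ := h1
    refine ⟨v * r, ?_⟩
    change ((v * r) /ₒ (1 : S) : OreLocalization S R) = r /ₒ s
    rw [OreLocalization.oreDiv_eq_iff]
    refine ⟨⟨t, ht⟩, t * s, ?_, by simp⟩
    rw [mul_sub, sub_eq_zero] at h
    simp only [Submonoid.smul_def, smul_eq_mul]
    rw [← h]
    simp only [mul_assoc]

end General

section Artinian

variable {R : Type*} [Ring R] [IsArtinianRing R] {S : Submonoid R}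

/-- The ideal `ass S` is annihilated on the left by one element of `S`: an element `t ∈ S` whose
double annihilator `{x | ∀ r, t r = 0 → x r = 0}` is minimal will do. -/
theorem exists_mul_ass_eq_zero (hS : IsLeftDenominatorSet S) :
    ∃ t ∈ S, ∀ x ∈ hS.ass, t * x = 0 := by
  let L : S → Ideal R := fun t =>
    { carrier := {x | ∀ r, (t : R) * r = 0 → x * r = 0}
      zero_mem' := fun r _ => zero_mul r
      add_mem' := fun {x y} hx hy r hr => by rw [add_mul, hx r hr, hy r hr, add_zero]
      smul_mem' := fun c x hx r hr => by rw [smul_eq_mul, mul_assoc, hx r hr, mul_zero] }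
  obtain ⟨_, ⟨t, rfl⟩, hmin⟩ :=
    wellFounded_lt.has_min (Set.range L) (Set.range_nonempty L)
  refine ⟨t, t.2, ?_⟩
  rintro x ⟨s, hs, hx⟩
  -- A left multiple of `t` in `S` has the same right annihilator as `t`; the Ore condition makes
  -- one that is also a left multiple of `s`.
  obtain ⟨s', hs', r', h⟩ := hS.ore t s hs
  let p : S := ⟨s' * t, S.mul_mem hs' t.2⟩
  have hle : L p ≤ L t := by
    intro y hy r hr
    refine hy r ?_
    change s' * t * r = 0
    rw [mul_assoc, hr, mul_zero]
  have heq : L p = L t := by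
    by_contra hne
    exact hmin _ ⟨p, rfl⟩ (lt_of_le_of_ne hle hne)
  have ht : (t : R) ∈ L p := by
    rw [heq]
    exact fun r hr => hr
  refine ht x ?_
  change s' * t * x = 0
  rw [h, mul_assoc, hx, mul_zero]

theorem isUnit_mk_ass (hS : IsLeftDenominatorSet S) {s : R} (hs : s ∈ S) :
    IsUnit (Ideal.Quotient.mk hS.ass s) := by
  rw [IsArtinianRing.isUnit_iff_isRightRegular]
  intro x y hxy
  obtain ⟨x, rfl⟩ := Ideal.Quotient.mk_surjective x
  obtain ⟨y, rfl⟩ := Ideal.Quotient.mk_surjective y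
  have hxy' : Ideal.Quotient.mk hS.ass (x * s) = Ideal.Quotient.mk hS.ass (y * s) := by
    simpa using hxy
  rw [Ideal.Quotient.mk_eq_mk_iff_sub_mem] at hxy' ⊢
  exact hS.mem_ass_of_mul_mem_ass_right hs (by rwa [sub_mul])

/-- The ideal `ass S` has a left identity element. -/
theorem exists_mem_ass_mul_eq (hS : IsLeftDenominatorSet S) :
    ∃ g ∈ hS.ass, ∀ x ∈ hS.ass, g * x = x := by
  obtain ⟨t, ht, h⟩ := hS.exists_mul_ass_eq_zero
  obtain ⟨w, hw⟩ := Ideal.Quotient.mk_surjective (↑(hS.isUnit_mk_ass ht).unit⁻¹ : R ⧸ hS.ass)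
  refine ⟨1 - w * t, ?_, fun x hx => ?_⟩
  · rw [← Ideal.Quotient.eq_zero_iff_mem, map_sub, map_mul, hw, IsUnit.val_inv_mul, map_one,
      sub_self]
  · rw [sub_mul, mul_assoc, h x hx, mul_zero, sub_zero, one_mul]

end Artinian

end IsLeftDenominatorSet

/-! ### The elements that are invertible modulo an ideal -/

/-- The multiplicative submonoid of the elements of `R` that are units modulo the ideal `a`. -/
def unitsModulo {R : Type*} [Ring R] (a : Ideal R) [a.IsTwoSided] : Submonoid R :=
  (IsUnit.submonoid (R ⧸ a)).comap (Ideal.Quotient.mk a)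

section UnitsModulo

variable {R : Type*} [Ring R]

theorem mem_unitsModulo {a : Ideal R} [a.IsTwoSided] {u : R} :
    u ∈ unitsModulo a ↔ IsUnit (Ideal.Quotient.mk a u) := Iff.rfl

theorem unitsModulo_mono {a b : Ideal R} [a.IsTwoSided] [b.IsTwoSided] (h : a ≤ b) :
    unitsModulo a ≤ unitsModulo b := fun _ hu =>
  IsUnit.map (Ideal.Quotient.factor h) (mem_unitsModulo.1 hu)

theorem mem_oneSubIdeal_iff {f : R} (hf : IsIdempotentElem f)
    (he : ∀ r : R, f * r * (1 - f) = 0) {x : R} : x ∈ oneSubIdeal f he ↔ f * x = 0 := by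
  constructor
  · rintro ⟨r, rfl⟩
    rw [← mul_assoc, mul_sub, mul_one, hf.eq, sub_self, zero_mul]
  · intro h
    exact ⟨x, by rw [sub_mul, h, one_mul, sub_zero]⟩

theorem mk_oneSubIdeal_self {f : R} (hf : IsIdempotentElem f)
    (he : ∀ r : R, f * r * (1 - f) = 0) : Ideal.Quotient.mk (oneSubIdeal f he) f = 1 := by
  rw [← map_one (Ideal.Quotient.mk (oneSubIdeal f he)), Ideal.Quotient.mk_eq_mk_iff_sub_mem,
    mem_oneSubIdeal_iff hf, mul_sub, hf.eq, mul_one, sub_self]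

theorem self_mem_unitsModulo {f : R} (hf : IsIdempotentElem f)
    (he : ∀ r : R, f * r * (1 - f) = 0) : f ∈ unitsModulo (oneSubIdeal f he) := by
  rw [mem_unitsModulo, mk_oneSubIdeal_self hf he]
  exact isUnit_one

/-- The idempotent `f` itself belongs to the set and annihilates the ideal, which makes it a
universal denominator. -/
theorem isLeftDenominatorSet_unitsModulo {f : R} (hf : IsIdempotentElem f) (hf0 : f ≠ 0)
    (he : ∀ r : R, f * r * (1 - f) = 0) :
    IsLeftDenominatorSet (unitsModulo (oneSubIdeal f he)) where
  zero_notMem h := by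
    rw [mem_unitsModulo, map_zero, isUnit_zero_iff, ← mk_oneSubIdeal_self hf he, eq_comm,
      Ideal.Quotient.eq_zero_iff_mem, mem_oneSubIdeal_iff hf, hf.eq] at h
    exact hf0 h
  ore r s hs := by
    obtain ⟨v, hv⟩ := Ideal.Quotient.mk_surjective
      (↑(mem_unitsModulo.1 hs).unit⁻¹ : R ⧸ oneSubIdeal f he)
    refine ⟨f, self_mem_unitsModulo hf he, f * r * v, ?_⟩
    have h : Ideal.Quotient.mk (oneSubIdeal f he) (r - r * v * s) = 0 := by
      rw [map_sub, map_mul, map_mul, hv, mul_assoc, IsUnit.val_inv_mul, mul_one, sub_self]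
    rw [Ideal.Quotient.eq_zero_iff_mem, mem_oneSubIdeal_iff hf, mul_sub, sub_eq_zero] at h
    simpa only [mul_assoc] using h
  reversible r s hs h := by
    refine ⟨f, self_mem_unitsModulo hf he, ?_⟩
    rw [← mem_oneSubIdeal_iff hf he, ← Ideal.Quotient.eq_zero_iff_mem]
    have h' := congrArg (Ideal.Quotient.mk (oneSubIdeal f he)) h
    rw [map_mul, map_zero] at h'
    exact (mem_unitsModulo.1 hs).mul_left_eq_zero.1 h'

theorem ass_unitsModulo {f : R} (hf : IsIdempotentElem f)
    (he : ∀ r : R, f * r * (1 - f) = 0)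
    (hS : IsLeftDenominatorSet (unitsModulo (oneSubIdeal f he))) :
    hS.ass = oneSubIdeal f he := by
  ext x
  constructor
  · rintro ⟨s, hs, h⟩
    have h' := congrArg (Ideal.Quotient.mk (oneSubIdeal f he)) h
    rw [map_mul, map_zero] at h'
    rw [← Ideal.Quotient.eq_zero_iff_mem]
    exact (mem_unitsModulo.1 hs).mul_right_eq_zero.1 h'
  · intro hx
    exact ⟨f, self_mem_unitsModulo hf he, (mem_oneSubIdeal_iff hf he).1 hx⟩

end UnitsModulo

/-! ### The idempotents `e_I` -/

namespace BlockIdempotents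

section Idempotents

variable {R : Type u} [Ring R] (B : BlockIdempotents R)

theorem idem_mul_partialSum (I : Finset (Fin B.n)) (i : Fin B.n) :
    B.idem i * B.partialSum I = if i ∈ I then B.idem i else 0 := by
  rw [partialSum, Finset.mul_sum]
  simp only [B.complete.toOrthogonalIdempotents.mul_eq, Finset.sum_ite_eq]

theorem partialSum_mul_partialSum (I K : Finset (Fin B.n)) :
    B.partialSum I * B.partialSum K = B.partialSum (I ∩ K) := by
  rw [partialSum, Finset.sum_mul]
  simp only [idem_mul_partialSum]
  rw [Finset.sum_ite_mem]
  rfl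

theorem isIdempotentElem_partialSum (I : Finset (Fin B.n)) :
    IsIdempotentElem (B.partialSum I) := by
  rw [IsIdempotentElem, partialSum_mul_partialSum, Finset.inter_self]

theorem partialSum_univ : B.partialSum Finset.univ = 1 := B.complete.complete

theorem partialSum_add_partialSum_compl (I : Finset (Fin B.n)) :
    B.partialSum I + B.partialSum Iᶜ = 1 := by
  rw [← partialSum_univ]
  exact Finset.sum_add_sum_compl I _

theorem partialSum_mul_eq_zero_iff (I : Finset (Fin B.n)) (x : R) :
    B.partialSum I * x = 0 ↔ ∀ i ∈ I, B.idem i * x = 0 := by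
  constructor
  · intro h i hi
    have h' := B.idem_mul_partialSum I i
    rw [if_pos hi] at h'
    rw [← h', mul_assoc, h, mul_zero]
  · intro h
    rw [partialSum, Finset.sum_mul]
    exact Finset.sum_eq_zero h

/-- The projection of `R` onto its `i`-th simple block. -/
def toBlock (i : Fin B.n) :
    letI := B.ring
    R →+* B.Block i :=
  letI := B.ring
  (Pi.evalRingHom B.Block i).comp
    ((B.equiv : (R ⧸ Ring.jacobson R) →+* (∀ i, B.Block i)).comp
      (Ideal.Quotient.mk (Ring.jacobson R)))

theorem toBlock_surjective (i : Fin B.n) : Function.Surjective (B.toBlock i) := by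
  let := B.ring
  intro b
  obtain ⟨r, hr⟩ := Ideal.Quotient.mk_surjective (B.equiv.symm (Pi.single i b))
  refine ⟨r, ?_⟩
  change B.equiv (Ideal.Quotient.mk (Ring.jacobson R) r) i = b
  rw [hr, RingEquiv.apply_symm_apply, Pi.single_eq_same]

theorem toBlock_idem (i k : Fin B.n) :
    letI := B.ring
    B.toBlock k (B.idem i) = if k = i then 1 else 0 := by
  let := B.ring
  change B.equiv (Ideal.Quotient.mk (Ring.jacobson R) (B.idem i)) k = _
  rw [B.lifts]
  split_ifs with h
  · subst h
    rw [Pi.single_eq_same]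
  · rw [Pi.single_eq_of_ne h]

theorem mem_jacobson_of_toBlock_eq_zero {x : R}
    (h : letI := B.ring; ∀ i, B.toBlock i x = 0) : x ∈ Ring.jacobson R := by
  let := B.ring
  rw [← Ideal.Quotient.eq_zero_iff_mem]
  apply B.equiv.injective
  rw [map_zero]
  exact funext h

theorem idem_ne_zero (i : Fin B.n) : B.idem i ≠ 0 := by
  let := B.ring
  let := B.simple
  intro h
  have h1 := B.toBlock_idem i i
  rw [h, map_zero, if_pos rfl] at h1
  exact zero_ne_one h1

theorem partialSum_ne_zero {I : Finset (Fin B.n)} (hI : I.Nonempty) : B.partialSum I ≠ 0 := by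
  obtain ⟨i, hi⟩ := hI
  intro h
  have h' := B.idem_mul_partialSum I i
  rw [if_pos hi, h, mul_zero] at h'
  exact B.idem_ne_zero i h'.symm

/-- The condition `e_I R (1 - e_I) = 0` says that `I` is closed under the relation
`1_i R 1_k ≠ 0` between `i` and `k`. -/
theorem partialSum_mul_mul_eq_zero_iff (I : Finset (Fin B.n)) :
    (∀ r, B.partialSum I * r * (1 - B.partialSum I) = 0) ↔
      ∀ i ∈ I, ∀ k ∉ I, ∀ r, B.idem i * r * B.idem k = 0 := by
  have h1 : 1 - B.partialSum I = B.partialSum Iᶜ := by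
    rw [← B.partialSum_add_partialSum_compl I, add_sub_cancel_left]
  rw [h1]
  constructor
  · intro h i hi k hk r
    have hi' := B.idem_mul_partialSum I i
    have hk' := B.partialSum_mul_partialSum Iᶜ {k}
    rw [if_pos hi] at hi'
    rw [Finset.inter_singleton_of_mem (Finset.mem_compl.2 hk)] at hk'
    simp only [partialSum, Finset.sum_singleton] at hk' hi' h
    rw [← hi', ← hk']
    calc _ = B.idem i * ((∑ i ∈ I, B.idem i) * r * ∑ i ∈ Iᶜ, B.idem i) * B.idem k := by
          simp only [mul_assoc]
      _ = 0 := by rw [h r, mul_zero, zero_mul]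
  · intro h r
    rw [partialSum, partialSum, Finset.sum_mul, Finset.sum_mul]
    refine Finset.sum_eq_zero fun i hi => ?_
    rw [Finset.mul_sum]
    exact Finset.sum_eq_zero fun k hk => h i hi k (Finset.mem_compl.1 hk) r

theorem inter_mem_leftIndex {I K : Finset (Fin B.n)} (hI : I ∈ B.leftIndex)
    (hK : K ∈ B.leftIndex) (h : (I ∩ K).Nonempty) : I ∩ K ∈ B.leftIndex := by
  refine ⟨h, (B.partialSum_mul_mul_eq_zero_iff _).2 fun i hi k hk r => ?_⟩
  rw [Finset.mem_inter] at hi hk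
  by_cases hkI : k ∈ I
  · exact (B.partialSum_mul_mul_eq_zero_iff K).1 hK.2 i hi.2 k (fun hkK => hk ⟨hkI, hkK⟩) r
  · exact (B.partialSum_mul_mul_eq_zero_iff I).1 hI.2 i hi.1 k hkI r

theorem eq_of_mem_minLeftIndex {I K : Finset (Fin B.n)} (hI : I ∈ B.minLeftIndex)
    (hK : K ∈ B.minLeftIndex) (h : (I ∩ K).Nonempty) : I = K := by
  have hIK := B.inter_mem_leftIndex hI.prop hK.prop h
  exact (hI.eq_of_le hIK Finset.inter_subset_left).symm.trans
    (hK.eq_of_le hIK Finset.inter_subset_right)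

theorem exists_minLeftIndex_subset {I : Finset (Fin B.n)} (hI : I ∈ B.leftIndex) :
    ∃ K ∈ B.minLeftIndex, K ⊆ I := by
  obtain ⟨K, hKI, hK⟩ := exists_minimal_le_of_wellFoundedLT (· ∈ B.leftIndex) I hI
  exact ⟨K, hK, hKI⟩

theorem univ_mem_leftIndex [Nontrivial R] : Finset.univ ∈ B.leftIndex := by
  refine ⟨?_, fun r => by rw [partialSum_univ, sub_self, mul_zero]⟩
  rw [Finset.nonempty_iff_ne_empty]
  intro h
  have h1 := B.partialSum_univ
  rw [h, partialSum, Finset.sum_empty] at h1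
  exact zero_ne_one h1

/-- The union of the minimal elements of `𝓘'_l(R)`. -/
noncomputable def minSupport : Finset (Fin B.n) :=
  (Set.toFinite B.minLeftIndex).toFinset.biUnion id

theorem mem_minSupport {i : Fin B.n} : i ∈ B.minSupport ↔ ∃ I ∈ B.minLeftIndex, i ∈ I := by
  simp [minSupport]

theorem sumMin_eq : B.sumMin = B.partialSum B.minSupport := by
  rw [sumMin, minSupport, partialSum, Finset.sum_biUnion]
  · rfl
  · intro I hI K hK hne
    rw [Set.Finite.coe_toFinset] at hI hK
    rw [Function.onFun, Finset.disjoint_iff_inter_eq_empty, ← Finset.not_nonempty_iff_eq_empty]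
    exact fun h => hne (B.eq_of_mem_minLeftIndex hI hK h)

theorem minSupport_mem_leftIndex [Nontrivial R] : B.minSupport ∈ B.leftIndex := by
  constructor
  · obtain ⟨I, hI, -⟩ := B.exists_minLeftIndex_subset B.univ_mem_leftIndex
    obtain ⟨i, hi⟩ := hI.prop.1
    exact ⟨i, B.mem_minSupport.2 ⟨I, hI, hi⟩⟩
  · refine (B.partialSum_mul_mul_eq_zero_iff _).2 fun i hi k hk r => ?_
    obtain ⟨I, hI, hiI⟩ := B.mem_minSupport.1 hi
    exact (B.partialSum_mul_mul_eq_zero_iff I).1 hI.prop.2 i hiI k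
      (fun hkI => hk (B.mem_minSupport.2 ⟨I, hI, hkI⟩)) r

theorem sumMin_mul_mul_eq_zero [Nontrivial R] (r : R) : B.sumMin * r * (1 - B.sumMin) = 0 := by
  rw [sumMin_eq]
  exact B.minSupport_mem_leftIndex.2 r

theorem isIdempotentElem_sumMin : IsIdempotentElem B.sumMin := by
  rw [sumMin_eq]
  exact B.isIdempotentElem_partialSum _

theorem mem_minIdeal_iff (I : B.minLeftIndex) (x : R) :
    x ∈ B.minIdeal I ↔ B.partialSum I.1 * x = 0 :=
  mem_oneSubIdeal_iff (B.isIdempotentElem_partialSum _) _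

theorem partialSum_minSupport_mul_eq_zero_iff (x : R) :
    B.partialSum B.minSupport * x = 0 ↔ ∀ I : B.minLeftIndex, x ∈ B.minIdeal I := by
  simp only [mem_minIdeal_iff, partialSum_mul_eq_zero_iff, mem_minSupport]
  exact ⟨fun h I i hi => h i ⟨I.1, I.2, hi⟩, fun h i ⟨I, hI, hi⟩ => h ⟨I, hI⟩ i hi⟩

/-- The Chinese remainder theorem for the ideals `(1 - e')R`, which are comaximal because distinct
minimal index sets are disjoint. -/
theorem exists_forall_sub_mem_minIdeal (x : B.minLeftIndex → R) :
    ∃ r, ∀ I, r - x I ∈ B.minIdeal I := by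
  have : Fintype B.minLeftIndex := Fintype.ofFinite _
  refine ⟨∑ K : B.minLeftIndex, B.partialSum K.1 * x K, fun I => ?_⟩
  rw [mem_minIdeal_iff, mul_sub, Finset.mul_sum, Finset.sum_eq_single I]
  · rw [← mul_assoc, (B.isIdempotentElem_partialSum I.1).eq, sub_self]
  · intro K _ hK
    have h : I.1 ∩ K.1 = ∅ := by
      rw [← Finset.not_nonempty_iff_eq_empty]
      exact fun h => hK (Subtype.ext (B.eq_of_mem_minLeftIndex I.2 K.2 h).symm)
    rw [← mul_assoc, partialSum_mul_partialSum, h, partialSum, Finset.sum_empty, zero_mul]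
  · exact fun h => absurd (Finset.mem_univ I) h

theorem mem_oneSubIdeal_sumMin_iff (he : ∀ r : R, B.sumMin * r * (1 - B.sumMin) = 0) (x : R) :
    x ∈ oneSubIdeal B.sumMin he ↔ ∀ I : B.minLeftIndex, x ∈ B.minIdeal I := by
  rw [mem_oneSubIdeal_iff B.isIdempotentElem_sumMin, sumMin_eq,
    partialSum_minSupport_mul_eq_zero_iff]

theorem exists_ringEquiv_quotient_sumMin (he : ∀ r : R, B.sumMin * r * (1 - B.sumMin) = 0) :
    ∃ φ : (R ⧸ oneSubIdeal B.sumMin he) ≃+* (∀ I : B.minLeftIndex, R ⧸ B.minIdeal I),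
      ∀ r : R, φ (Ideal.Quotient.mk (oneSubIdeal B.sumMin he) r) =
        fun I => Ideal.Quotient.mk (B.minIdeal I) r := by
  refine RingHom.exists_ringEquiv_of_ker_eq _
    (RingHom.pi fun I : B.minLeftIndex => Ideal.Quotient.mk (B.minIdeal I))
    Ideal.Quotient.mk_surjective (fun q => ?_) fun r => ?_
  · choose x hx using fun I => Ideal.Quotient.mk_surjective (q I)
    obtain ⟨r, hr⟩ := B.exists_forall_sub_mem_minIdeal x
    refine ⟨r, funext fun I => ?_⟩
    rw [← hx I]
    exact (Ideal.Quotient.mk_eq_mk_iff_sub_mem _ _).2 (hr I)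
  · rw [Ideal.Quotient.eq_zero_iff_mem, mem_oneSubIdeal_sumMin_iff, funext_iff]
    exact forall_congr' fun I => Ideal.Quotient.eq_zero_iff_mem.symm

end Idempotents

/-! ### The maximal left denominator sets -/

section Maximal

variable {R : Type u} [Ring R] (B : BlockIdempotents R)

/-- The left denominator set `S_I` of the elements that are units modulo `(1 - e_I)R`, for a minimal
element `e_I` of `𝓘'_l(R)`. -/
def minDen (I : B.minLeftIndex) : Submonoid R := unitsModulo (B.minIdeal I)

theorem isLeftDenominatorSet_minDen (I : B.minLeftIndex) : IsLeftDenominatorSet (B.minDen I) :=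
  isLeftDenominatorSet_unitsModulo (B.isIdempotentElem_partialSum I.1)
    (B.partialSum_ne_zero I.2.prop.1) _

theorem ass_minDen (I : B.minLeftIndex) (hS : IsLeftDenominatorSet (B.minDen I)) :
    hS.ass = B.minIdeal I :=
  ass_unitsModulo (B.isIdempotentElem_partialSum I.1) _ hS

/-- There are no inclusions between distinct `S_I`: an inclusion `S_I ⊆ S_K` would give
`(1 - e_I)R ⊆ (1 - e_K)R`, that is, `K ⊆ I`. -/
theorem eq_of_minDen_le {I K : B.minLeftIndex} (h : B.minDen I ≤ B.minDen K) : I = K := by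
  have hmem : 1 - B.partialSum I.1 ∈ B.minIdeal K := by
    rw [← B.ass_minDen K (B.isLeftDenominatorSet_minDen K)]
    refine ⟨B.partialSum I.1, h (self_mem_unitsModulo (B.isIdempotentElem_partialSum I.1) _), ?_⟩
    rw [mul_sub, mul_one, (B.isIdempotentElem_partialSum I.1).eq, sub_self]
  rw [mem_minIdeal_iff, partialSum_mul_eq_zero_iff] at hmem
  have hsub : K.1 ⊆ I.1 := by
    intro k hk
    by_contra hkI
    have h1 := hmem k hk
    rw [mul_sub, mul_one, idem_mul_partialSum, if_neg hkI, sub_zero] at h1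
    exact B.idem_ne_zero k h1
  exact Subtype.ext (I.2.eq_of_le K.2.prop hsub).symm

variable [IsArtinianRing R]

theorem isNilpotent_of_mem_jacobson {x : R} (hx : x ∈ Ring.jacobson R) :
    IsNilpotent x := by
  obtain ⟨k, hk⟩ := IsSemiprimaryRing.isNilpotent (R := R)
  exact ⟨k, by simpa [hk] using Ideal.pow_mem_pow hx k⟩

/-- A two-sided ideal `a` that has a left identity element `g` is annihilated by `e_I`, where `I` is
the set of the `i` with `1_i ∉ a`: the element `e_I g` is an idempotent and lies in the radical. -/
theorem partialSum_mul_eq_zero_of_left_identity (a : Ideal R) [a.IsTwoSided] {g : R} (hg : g ∈ a)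
    (hga : ∀ x ∈ a, g * x = x) (I : Finset (Fin B.n)) (hI : ∀ i, i ∈ I ↔ B.idem i ∉ a) :
    B.partialSum I * g = 0 := by
  let := B.ring
  let := B.simple
  -- The image of `a` in the `i`-th block is everything only if `1_i` becomes nilpotent modulo `a`.
  have hblock : ∀ i ∈ I, ∀ y ∈ a, B.toBlock i y = 0 := by
    intro i hi
    refine ((B.toBlock i).map_eq_zero_or_exists_eq_one (B.toBlock_surjective i) a).resolve_right ?_
    rintro ⟨y, hy, hy1⟩
    refine (hI i).1 hi ?_
    have hj : B.idem i - B.idem i * y ∈ Ring.jacobson R := by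
      refine B.mem_jacobson_of_toBlock_eq_zero fun k => ?_
      rw [map_sub, map_mul, toBlock_idem]
      split_ifs with h
      · rw [h, hy1, mul_one, sub_self]
      · rw [zero_mul, sub_self]
    have hn := (isNilpotent_of_mem_jacobson hj).map (Ideal.Quotient.mk a)
    rw [map_sub, map_mul, Ideal.Quotient.eq_zero_iff_mem.2 hy, mul_zero, sub_zero] at hn
    rw [← Ideal.Quotient.eq_zero_iff_mem]
    exact ((B.complete.idem i).map (Ideal.Quotient.mk a)).eq_zero_of_isNilpotent hn
  have hc : g * B.partialSum Iᶜ = B.partialSum Iᶜ := by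
    refine hga _ (a.sum_mem fun i hi => ?_)
    by_contra h
    exact Finset.mem_compl.1 hi ((hI i).2 h)
  have hidem : IsIdempotentElem (B.partialSum I * g) := by
    have h1 : g * B.partialSum I = g - B.partialSum Iᶜ := by
      rw [← hc, eq_sub_iff_add_eq, ← mul_add, partialSum_add_partialSum_compl, mul_one]
    have h2 : B.partialSum I * B.partialSum Iᶜ = 0 := by
      rw [partialSum_mul_partialSum, Finset.inter_compl, partialSum, Finset.sum_empty]
    rw [IsIdempotentElem, mul_assoc, ← mul_assoc g, h1, sub_mul, hga g hg, mul_sub,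
      ← mul_assoc (B.partialSum I), h2, zero_mul, sub_zero]
  refine hidem.eq_zero_of_isNilpotent (isNilpotent_of_mem_jacobson
    (B.mem_jacobson_of_toBlock_eq_zero fun i => ?_))
  by_cases hi : i ∈ I
  · rw [map_mul, hblock i hi g hg, mul_zero]
  · rw [map_mul, partialSum, map_sum, Finset.sum_eq_zero, zero_mul]
    intro k hk
    rw [toBlock_idem, if_neg]
    rintro rfl
    exact hi hk

theorem exists_leftIndex_mem_iff {S : Submonoid R} (hS : IsLeftDenominatorSet S) :
    ∃ I ∈ B.leftIndex, ∀ x, x ∈ hS.ass ↔ B.partialSum I * x = 0 := by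
  classical
  obtain ⟨g, hg, hga⟩ := hS.exists_mem_ass_mul_eq
  let I : Finset (Fin B.n) := Finset.univ.filter fun i => B.idem i ∉ hS.ass
  have hI : ∀ i, i ∈ I ↔ B.idem i ∉ hS.ass := fun i => by simp [I]
  have hIg := B.partialSum_mul_eq_zero_of_left_identity hS.ass hg hga I hI
  have hc : B.partialSum Iᶜ ∈ hS.ass := by
    refine hS.ass.sum_mem fun i hi => ?_
    by_contra h
    exact Finset.mem_compl.1 hi ((hI i).2 h)
  have hmem : ∀ x, x ∈ hS.ass ↔ B.partialSum I * x = 0 := by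
    intro x
    constructor
    · intro hx
      rw [← hga x hx, ← mul_assoc, hIg, zero_mul]
    · intro hx
      rw [← one_mul x, ← B.partialSum_add_partialSum_compl I, add_mul, hx, zero_add]
      exact hS.ass.mul_mem_right x hc
  refine ⟨I, ⟨?_, fun r => ?_⟩, hmem⟩
  · rw [Finset.nonempty_iff_ne_empty]
    intro h
    have h1 : (1 : R) ∈ hS.ass := by
      rw [hmem, h, partialSum, Finset.sum_empty, zero_mul]
    obtain ⟨s, hs, h1⟩ := h1
    rw [mul_one] at h1
    exact hS.zero_notMem (h1 ▸ hs)
  · have h1 : 1 - B.partialSum I = B.partialSum Iᶜ := by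
      rw [← B.partialSum_add_partialSum_compl I, add_sub_cancel_left]
    rw [h1, mul_assoc, ← hmem]
    exact hS.ass.mul_mem_left r hc

theorem exists_le_minDen {S : Submonoid R} (hS : IsLeftDenominatorSet S) :
    ∃ I : B.minLeftIndex, S ≤ B.minDen I := by
  obtain ⟨I, hI, hmem⟩ := B.exists_leftIndex_mem_iff hS
  obtain ⟨K, hK, hKI⟩ := B.exists_minLeftIndex_subset hI
  refine ⟨⟨K, hK⟩, fun s hs => ?_⟩
  have hle : hS.ass ≤ B.minIdeal ⟨K, hK⟩ := by
    intro x hx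
    rw [mem_minIdeal_iff, partialSum_mul_eq_zero_iff]
    exact fun i hi => (B.partialSum_mul_eq_zero_iff I x).1 ((hmem x).1 hx) i (hKI hi)
  exact unitsModulo_mono hle (hS.isUnit_mk_ass hs)

theorem mem_maxLeftDen_iff {S : Submonoid R} :
    S ∈ maxLeftDen R ↔ ∃ I : B.minLeftIndex, S = B.minDen I := by
  constructor
  · intro hS
    obtain ⟨I, hI⟩ := B.exists_le_minDen hS.prop
    exact ⟨I, hS.eq_of_le (B.isLeftDenominatorSet_minDen I) hI⟩
  · rintro ⟨I, rfl⟩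
    refine ⟨B.isLeftDenominatorSet_minDen I, fun T hT hIT => ?_⟩
    obtain ⟨K, hK⟩ := B.exists_le_minDen hT
    rwa [B.eq_of_minDen_le (hIT.trans hK)]

theorem minDen_mem_maxLeftDen (I : B.minLeftIndex) : B.minDen I ∈ maxLeftDen R :=
  B.mem_maxLeftDen_iff.2 ⟨I, rfl⟩

theorem stronglyLeftLocalizable_eq :
    stronglyLeftLocalizable R =
      {u : R | ∀ I : B.minLeftIndex, IsUnit (Ideal.Quotient.mk (B.minIdeal I) u)} := by
  ext u
  rw [stronglyLeftLocalizable, Set.mem_iInter₂]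
  constructor
  · exact fun h I => h _ (B.minDen_mem_maxLeftDen I)
  · intro h S hS
    obtain ⟨I, rfl⟩ := B.mem_maxLeftDen_iff.1 hS
    exact h I

theorem leftLocalizationRadical_mem_iff (x : R) :
    x ∈ leftLocalizationRadical R ↔ ∀ I : B.minLeftIndex, x ∈ B.minIdeal I := by
  rw [leftLocalizationRadical, Submodule.mem_iInf]
  constructor
  · intro h I
    rw [← B.ass_minDen I (B.isLeftDenominatorSet_minDen I)]
    exact h ⟨_, B.minDen_mem_maxLeftDen I⟩
  · rintro h ⟨S, hS⟩
    obtain ⟨I, rfl⟩ := B.mem_maxLeftDen_iff.1 hS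
    rw [B.ass_minDen]
    exact h I

/-! ### The largest strong left denominator set -/

/-- Being a unit in a product of rings is a componentwise condition, so that the intersection of the
maximal left denominator sets is the set of the units modulo `(1 - e)R`. -/
theorem coe_unitsModulo_sumMin (he : ∀ r : R, B.sumMin * r * (1 - B.sumMin) = 0) :
    (unitsModulo (oneSubIdeal B.sumMin he) : Set R) = stronglyLeftLocalizable R := by
  obtain ⟨φ, hφ⟩ := B.exists_ringEquiv_quotient_sumMin he
  ext u
  rw [B.stronglyLeftLocalizable_eq, SetLike.mem_coe, mem_unitsModulo, ← isUnit_map_iff φ, hφ,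
    Pi.isUnit_iff]
  rfl

theorem largestStrongLeftDen_eq [Nontrivial R]
    (he : ∀ r : R, B.sumMin * r * (1 - B.sumMin) = 0) :
    largestStrongLeftDen R = unitsModulo (oneSubIdeal B.sumMin he) := by
  have hne : B.sumMin ≠ 0 := by
    rw [sumMin_eq]
    exact B.partialSum_ne_zero B.minSupport_mem_leftIndex.1
  refine le_antisymm (fun u hu => ?_) ?_
  · rw [← SetLike.mem_coe, B.coe_unitsModulo_sumMin]
    exact (isGreatest_largestStrongLeftDen R).1.2 hu
  · exact (isGreatest_largestStrongLeftDen R).2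
      ⟨isLeftDenominatorSet_unitsModulo B.isIdempotentElem_sumMin hne he,
        (B.coe_unitsModulo_sumMin he).subset⟩

theorem strongLeftLocalizationRadical_eq [Nontrivial R]
    (he : ∀ r : R, B.sumMin * r * (1 - B.sumMin) = 0) :
    strongLeftLocalizationRadical R = oneSubIdeal B.sumMin he := by
  have h : ∀ (S : Submonoid R) (hS : IsLeftDenominatorSet S),
      S = unitsModulo (oneSubIdeal B.sumMin he) → hS.ass = oneSubIdeal B.sumMin he := by
    rintro _ hS rfl
    exact ass_unitsModulo B.isIdempotentElem_sumMin he hS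
  exact h _ _ (B.largestStrongLeftDen_eq he)

theorem pi_toLocalization_surjective (B : BlockIdempotents R) :
    Function.Surjective (RingHom.pi fun S : maxLeftDen R =>
      (isLeftDenominatorSet_of_mem_maxLeftDen S.2).toLocalization) := by
  intro q
  choose x hx using fun S : maxLeftDen R =>
    (isLeftDenominatorSet_of_mem_maxLeftDen S.2).toLocalization_surjective
      (fun s hs => (isLeftDenominatorSet_of_mem_maxLeftDen S.2).isUnit_mk_ass hs) (q S)
  obtain ⟨r, hr⟩ := B.exists_forall_sub_mem_minIdeal
    fun I => x ⟨B.minDen I, B.minDen_mem_maxLeftDen I⟩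
  refine ⟨r, funext fun S => ?_⟩
  rw [← hx S]
  change IsLeftDenominatorSet.toLocalization _ r = _
  rw [← sub_eq_zero, ← map_sub, IsLeftDenominatorSet.toLocalization_eq_zero_iff]
  obtain ⟨S, hS⟩ := S
  obtain ⟨I, rfl⟩ := B.mem_maxLeftDen_iff.1 hS
  rw [B.ass_minDen]
  exact hr I

end Maximal

end BlockIdempotents

theorem mainTheorem9 (R : Type u) [Ring R] [Nontrivial R] [IsArtinianRing R]
    (B : BlockIdempotents R) :
    -- (1) the largest strong left denominator set
    ((largestStrongLeftDen R : Set R) = ⋂ S ∈ maxLeftDen R, (S : Set R) ∧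
      (⋂ S ∈ maxLeftDen R, (S : Set R)) =
        {u : R | ∀ I : B.minLeftIndex, IsUnit (Ideal.Quotient.mk (B.minIdeal I) u)}) ∧
    ∃ he : ∀ r : R, B.sumMin * r * (1 - B.sumMin) = 0,
      -- (2) the radicals
      (strongLeftLocalizationRadical R = leftLocalizationRadical R ∧
        leftLocalizationRadical R = oneSubIdeal B.sumMin he) ∧
      -- (3) the quotient rings, all isomorphisms being compatible with the maps from `R`
      (∃ φ : LargestStrongLeftQuotientRing R ≃+* R ⧸ strongLeftLocalizationRadical R,
        ∀ r : R, φ (toLargestStrongLeftQuotientRing R r) =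
          Ideal.Quotient.mk (strongLeftLocalizationRadical R) r) ∧
      (∃ φ : (R ⧸ strongLeftLocalizationRadical R) ≃+* R ⧸ oneSubIdeal B.sumMin he,
        ∀ r : R, φ (Ideal.Quotient.mk (strongLeftLocalizationRadical R) r) =
          Ideal.Quotient.mk (oneSubIdeal B.sumMin he) r) ∧
      (∃ φ : (R ⧸ oneSubIdeal B.sumMin he) ≃+* (∀ I : B.minLeftIndex, R ⧸ B.minIdeal I),
        ∀ r : R, φ (Ideal.Quotient.mk (oneSubIdeal B.sumMin he) r) =
          fun I => Ideal.Quotient.mk (B.minIdeal I) r) ∧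
      (∃ φ : (∀ I : B.minLeftIndex, R ⧸ B.minIdeal I) ≃+*
          (∀ S : maxLeftDen R, (isLeftDenominatorSet_of_mem_maxLeftDen S.2).Localization),
        ∀ r : R, φ (fun I => Ideal.Quotient.mk (B.minIdeal I) r) =
          fun S => (isLeftDenominatorSet_of_mem_maxLeftDen S.2).toLocalization r) := by
  have he := B.sumMin_mul_mul_eq_zero
  have hl : ∀ x, x ∈ leftLocalizationRadical R ↔ x ∈ oneSubIdeal B.sumMin he := fun x => by
    rw [B.leftLocalizationRadical_mem_iff, B.mem_oneSubIdeal_sumMin_iff]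
  have hs := B.strongLeftLocalizationRadical_eq he
  refine ⟨⟨?_, B.stronglyLeftLocalizable_eq⟩, he, ⟨hs.trans (Ideal.ext hl).symm, Ideal.ext hl⟩,
    ?_, ?_, B.exists_ringEquiv_quotient_sumMin he, ?_⟩
  · rw [B.largestStrongLeftDen_eq he]
    exact B.coe_unitsModulo_sumMin he
  · refine RingHom.exists_ringEquiv_of_ker_eq _ _
      (IsLeftDenominatorSet.toLocalization_surjective _ fun s hs =>
        IsLeftDenominatorSet.isUnit_mk_ass _ hs) Ideal.Quotient.mk_surjective fun r => ?_
    rw [IsLeftDenominatorSet.toLocalization_eq_zero_iff, Ideal.Quotient.eq_zero_iff_mem]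
  · exact ⟨Ideal.quotEquivOfEq hs, fun r => rfl⟩
  · obtain ⟨φ, hφ⟩ := B.exists_ringEquiv_quotient_sumMin he
    obtain ⟨ψ, hψ⟩ := RingHom.exists_ringEquiv_of_ker_eq
      (Ideal.Quotient.mk (oneSubIdeal B.sumMin he)) _ Ideal.Quotient.mk_surjective
      B.pi_toLocalization_surjective fun r => by
        rw [Ideal.Quotient.eq_zero_iff_mem, ← hl, leftLocalizationRadical, Submodule.mem_iInf,
          funext_iff (f := RingHom.pi _ r)]
        exact forall_congr' fun S =>
          (IsLeftDenominatorSet.toLocalization_eq_zero_iff _ r).symm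
    refine ⟨φ.symm.trans ψ, fun r => ?_⟩
    rw [← hφ, RingEquiv.trans_apply, RingEquiv.symm_apply_apply, hψ]
    rfl
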